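/- Let $K$ be a field with $\operatorname{char} K\neq 2,3$, let $\overline K$ be an algebraic closure of $K$, and let $\mathcal E_2: y^2=x^3+c$ with $c\in K$ be an elliptic curve (so $c\neq 0$). Let $K_7=K(\mathcal E_2[7])\subseteq\overline K$ be the field obtained by adjoining to $K$ the coordinates of all points $P\in\mathcal E_2(\overline K)$ with $7P=O$. Let $\mathrm{Dic}_3=\langle a,x \mid a^6=1,\ x^2=a^3,\ xax^{-1}=a^{-1}\rangle$ be the dicyclic group of order $12$, and let $\mathrm{Dic}_3\rtimes\mathbb Z/6\mathbb Z$ be the semidirect product in which a generator of $\mathbb Z/6\mathbb Z$ acts on $\mathrm{Dic}_3$ by the automorphism $a\mapsto a$, $x\mapsto x^{-1}$. Then: 1. $K_7/K$ is a Galois extension, and $\operatorname{Gal}(K_7/K)$ is isomorphic to a subgroup of $\mathrm{Dic}_3\rtimes\mathbb Z/6\mathbb Z$. 2. If $[K_7:K]=72$, then $\operatorname{Gal}(K_7/K)\simeq \mathrm{Dic}_3\rtimes\mathbb Z/6\mathbb Z$. 3. This semidirect product is not the direct product: $\mathrm{Dic}_3\rtimes\mathbb Z/6\mathbb Z\not\simeq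 \mathrm{Dic}_3\times\mathbb Z/6\mathbb Z$. -/

import Mathlib

/-- The Weierstrass curve `y² = x³ + c`. -/
def mordellCurve {K : Type*} [CommRing K] (c : K) : WeierstrassCurve K where
  a₁ := 0
  a₂ := 0
  a₃ := 0
  a₄ := 0
  a₆ := c

/-- The coordinates, in the extension `L` of `K`, of the affine `L`-rational points `P` of `W`
with `m • P = 0`. -/
def torsionCoordinates {K : Type*} [Field K] (W : WeierstrassCurve K)
    (L : Type*) [Field L] [Algebra K L] [DecidableEq L] (m : ℕ) : Set L :=
  {z | ∃ (x y : L) (h : (W.baseChange L).toAffine.Nonsingular x y),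
    m • WeierstrassCurve.Affine.Point.some x y h = 0 ∧ (z = x ∨ z = y)}

/-- The `m`-th division field `K(W[m])` inside `L`; to be used with `L` an algebraic closure
of `K`. -/
def divisionField {K : Type*} [Field K] (W : WeierstrassCurve K)
    (L : Type*) [Field L] [Algebra K L] [DecidableEq L] (m : ℕ) : IntermediateField K L :=
  IntermediateField.adjoin K (torsionCoordinates W L m)

/-- The dicyclic group of order 12. Its elements are `a i` and `xa i` with `i : ZMod 6`; here `a 1`
has order 6, `xa 0` has order 4, `(xa 0)² = (a 1)³`, and `xa 0` inverts `a 1`. -/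
abbrev Dic3 : Type := QuaternionGroup 3

/-- The cyclic group of order 6, written multiplicatively. -/
abbrev C6 : Type := Multiplicative (ZMod 6)

/-- The map `a i ↦ a i`, `xa i ↦ xa (i + 3k)`. For odd `k` it fixes the cyclic subgroup of order 6
and sends each element of order 4 to its inverse; for even `k` it is the identity. -/
def dic3Twist (k : ZMod 6) : Dic3 → Dic3
  | .a i => .a i
  | .xa i => .xa (i + 3 * k : ZMod 6)

/-- The action of the cyclic group of order 6 on the dicyclic group of order 12 in which a
generator fixes the cyclic subgroup of order 6 and inverts the elements of order 4. -/
def dic3Action : C6 →* MulAut Dic3 where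
  toFun k :=
    { toFun := dic3Twist k.toAdd
      invFun := dic3Twist (-k.toAdd)
      left_inv := by revert k; decide
      right_inv := by revert k; decide
      map_mul' := by revert k; decide }
  map_one' := by ext g; revert g; decide
  map_mul' k l := by
    ext g
    revert k l g
    decide

/-- The semidirect product `Dic₃ ⋊ ℤ/6ℤ` for the action `dic3Action`. -/
abbrev Dic3SemidirectC6 : Type := Dic3 ⋊[dic3Action] C6

/-! For a primitive cube root of unity `ω`, the curve has the automorphism `ρ : (x, y) ↦ (ωx, y)`,
and `ρ² + ρ + 1 = 0`. Modulo 7 this polynomial has the distinct roots 2 and 4, so the 7-torsion is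
the direct sum of two eigenspaces (`exists_eq_add_of_seven_nsmul_eq_zero`,
`eq_zero_of_mordellRot_add_eq_zero`). On a nonzero eigenpoint `x³` and `y²` are determined, so each
eigenspace has at most six nonzero points and is at most a line over `𝔽₇`
(`exists_zsmul_eq_of_mordellRot`).

A Galois automorphism sends `ω` to `ω` or `ω²`, hence preserves or swaps the eigenspaces. When both
are nonzero it acts by monomial `2 × 2` matrices, and these form a group of order 72 isomorphic to
`Dic₃ ⋊ ℤ/6ℤ` (`exists_injective_of_monomial`). If an eigenspace vanishes, the action is scalar; the
order of the 7-torsion is never needed.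

Separability holds because eigenpoints are built from cube and square roots. The direct product is
excluded by a noncentral involution. -/

open WeierstrassCurve.Affine

/-! ### The automorphism of order 3 and the doubling formula -/

section MordellCurve

variable {K : Type*} [Field K] (c : K) (F : Type*) [Field F] [Algebra K F]

/-- The `F`-rational points of `y² = x³ + c`. -/
abbrev MordellPoint : Type _ := ((mordellCurve c).baseChange F).toAffine.Point

variable {c F}

@[simp] lemma mordellCurve_a₁ : (mordellCurve c).a₁ = 0 := rfl
@[simp] lemma mordellCurve_a₂ : (mordellCurve c).a₂ = 0 := rfl
@[simp] lemma mordellCurve_a₃ : (mordellCurve c).a₃ = 0 := rfl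
@[simp] lemma mordellCurve_a₄ : (mordellCurve c).a₄ = 0 := rfl
@[simp] lemma mordellCurve_a₆ : (mordellCurve c).a₆ = c := rfl

lemma mordellCurve_equation_iff (x y : F) :
    ((mordellCurve c).baseChange F).toAffine.Equation x y ↔ y ^ 2 = x ^ 3 + algebraMap K F c := by
  simp [WeierstrassCurve.Affine.equation_iff]

lemma mordellCurve_nonsingular_iff [(mordellCurve c).IsElliptic] (x y : F) :
    ((mordellCurve c).baseChange F).toAffine.Nonsingular x y ↔
      y ^ 2 = x ^ 3 + algebraMap K F c := by
  have : ((mordellCurve c).baseChange F).IsElliptic := by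
    unfold WeierstrassCurve.baseChange; infer_instance
  rw [← mordellCurve_equation_iff, WeierstrassCurve.Affine.equation_iff_nonsingular]

lemma mordellCurve_Δ : (mordellCurve c).Δ = -432 * c ^ 2 := by
  simp [WeierstrassCurve.Δ, WeierstrassCurve.b₂, WeierstrassCurve.b₄, WeierstrassCurve.b₆,
    WeierstrassCurve.b₈]
  ring

variable (c F) in
-- The discriminant is `-2⁴ · 3³ · c²`, so its being a unit excludes characteristics 2 and 3.
lemma mordellCurve_ne_zero [h : (mordellCurve c).IsElliptic] :
    (2 : F) ≠ 0 ∧ (3 : F) ≠ 0 ∧ algebraMap K F c ≠ 0 := by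
  have h0 : algebraMap K F (-432 * c ^ 2) ≠ 0 := by
    rw [← mordellCurve_Δ, map_ne_zero]
    exact h.isUnit.ne_zero
  have h1 : -(2 : F) ^ 4 * 3 ^ 3 * algebraMap K F c ^ 2 ≠ 0 := by
    convert h0 using 1
    simp only [map_mul, map_neg, map_pow, map_ofNat]
    ring
  refine ⟨?_, ?_, ?_⟩ <;> intro h <;> simp [h] at h1

@[simp]
lemma mordellCurve_negY (x y : F) :
    ((mordellCurve c).baseChange F).toAffine.negY x y = -y := by
  simp [WeierstrassCurve.Affine.negY]

@[simp]
lemma mordellCurve_addX (x₁ x₂ l : F) :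
    ((mordellCurve c).baseChange F).toAffine.addX x₁ x₂ l = l ^ 2 - x₁ - x₂ := by
  simp [WeierstrassCurve.Affine.addX]

@[simp]
lemma mordellCurve_addY (x₁ x₂ y₁ l : F) :
    ((mordellCurve c).baseChange F).toAffine.addY x₁ x₂ y₁ l =
      -(l * (l ^ 2 - x₁ - x₂ - x₁) + y₁) := by
  simp [WeierstrassCurve.Affine.addY, WeierstrassCurve.Affine.negAddY]

lemma mordellCurve_slope [DecidableEq F] (x₁ x₂ y₁ y₂ : F) :
    ((mordellCurve c).baseChange F).toAffine.slope x₁ x₂ y₁ y₂ =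
      if x₁ = x₂ then if y₁ = -y₂ then 0 else 3 * x₁ ^ 2 / (2 * y₁)
      else (y₁ - y₂) / (x₁ - x₂) := by
  simp [WeierstrassCurve.Affine.slope, WeierstrassCurve.baseChange, mordellCurve, two_mul]

variable {ω : F}

lemma pow_three_eq_one_of_sq_add_add_one (hω : ω ^ 2 + ω + 1 = 0) : ω ^ 3 = 1 := by
  linear_combination (ω - 1) * hω

lemma sq_sq_add_sq_add_one (hω : ω ^ 2 + ω + 1 = 0) : (ω ^ 2) ^ 2 + ω ^ 2 + 1 = 0 := by
  linear_combination (ω ^ 2 - ω + 1) * hω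

variable [DecidableEq F] [(mordellCurve c).IsElliptic]

/-- The automorphism `(x, y) ↦ (ωx, y)` of `y² = x³ + c`, for a primitive cube root of unity `ω`. -/
def mordellRot (hω : ω ^ 2 + ω + 1 = 0) : MordellPoint c F →+ MordellPoint c F where
  toFun P := match P with
    | 0 => 0
    | .some x y h => .some (ω * x) y <| by
        rw [mordellCurve_nonsingular_iff] at h ⊢
        rw [h, mul_pow, pow_three_eq_one_of_sq_add_add_one hω, one_mul]
  map_zero' := rfl
  map_add' := by
    have h3 := pow_three_eq_one_of_sq_add_add_one hω
    have h0 : ω ≠ 0 := by rintro rfl; simp at h3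
    rintro (_ | ⟨x₁, y₁, h₁⟩) (_ | ⟨x₂, y₂, h₂⟩)
    any_goals rfl
    by_cases hxy : x₁ = x₂ ∧ y₁ = -y₂
    · rw [Point.add_of_Y_eq hxy.1 (by simpa using hxy.2),
        Point.add_of_Y_eq (by rw [hxy.1]) (by simpa using hxy.2)]
    -- Scaling `x` by `ω` divides chord slopes by `ω`, and `ω⁻¹ = ω²`; tangent slopes scale by `ω²`
    -- directly.
    · have hs : ((mordellCurve c).baseChange F).toAffine.slope (ω * x₁) (ω * x₂) y₁ y₂ =
          ω ^ 2 * ((mordellCurve c).baseChange F).toAffine.slope x₁ x₂ y₁ y₂ := by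
        simp only [mordellCurve_slope, mul_right_inj' h0]
        split_ifs with hx
        · simp
        · ring
        · have : x₁ - x₂ ≠ 0 := sub_ne_zero.2 hx
          rw [← mul_sub]
          field_simp
          linear_combination (-(y₁ - y₂)) * h3
      rw [Point.add_some (by simpa using hxy), Point.add_some (by simpa [h0] using hxy)]
      simp only [hs, mordellCurve_addX, mordellCurve_addY, Point.some.injEq]
      generalize ((mordellCurve c).baseChange F).toAffine.slope x₁ x₂ y₁ y₂ = l
      constructor
      · linear_combination (-ω * l ^ 2) * h3
      · linear_combination (l ^ 3 * (ω ^ 3 + 1) - l * (2 * x₁ + x₂)) * h3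

lemma mordellRot_some (hω : ω ^ 2 + ω + 1 = 0) {x y : F}
    (h : ((mordellCurve c).baseChange F).toAffine.Nonsingular x y)
    (h' : ((mordellCurve c).baseChange F).toAffine.Nonsingular (ω * x) y) :
    mordellRot hω (.some x y h : MordellPoint c F) = .some (ω * x) y h' := rfl

/-- The three points lie on a common horizontal line, so they sum to zero; if `x = 0` that line is a
flex tangent. -/
lemma mordellRot_add_add (hω : ω ^ 2 + ω + 1 = 0) (P : MordellPoint c F) :
    mordellRot hω (mordellRot hω P) + mordellRot hω P + P = 0 := by
  obtain ⟨h2, hh3, hc⟩ := mordellCurve_ne_zero c F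
  have hω1 : ω ≠ 1 := by
    rintro rfl
    apply hh3
    linear_combination hω
  rcases P with _ | ⟨x, y, h⟩
  · rfl
  have he := (mordellCurve_nonsingular_iff x y).1 h
  have hr : (ω * x) = x → x = 0 := by
    intro hx
    have : (ω - 1) * x = 0 := by linear_combination hx
    exact (mul_eq_zero.1 this).resolve_left (sub_ne_zero.2 hω1)
  have key : ∀ h', (.some (ω * x) y h' : MordellPoint c F) + .some x y h =
      - mordellRot hω (mordellRot hω (.some x y h)) := by
    intro h'
    have hn : ¬ (ω * x = x ∧ y = -y) := by
      rintro ⟨hx, hy⟩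
      have hy0 : y = 0 := by
        have : 2 * y = 0 := by linear_combination hy
        exact (mul_eq_zero.1 this).resolve_left h2
      rw [hr hx, hy0] at he
      simp at he
      exact hc (by simpa using he.symm)
    rw [Point.add_some (by simpa using hn), mordellRot_some hω h h', mordellRot_some hω h'
      ((mordellCurve_nonsingular_iff _ _).2 (by
        rw [he]; linear_combination (-x ^ 3 * (ω ^ 3 + 1)) *
          pow_three_eq_one_of_sq_add_add_one hω)), Point.neg_some]
    have hs : ((mordellCurve c).baseChange F).toAffine.slope (ω * x) x y y = 0 := by
      rw [mordellCurve_slope]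
      split_ifs with hx
      · rfl
      · simp [hr hx]
      · simp
    simp only [hs, mordellCurve_addX, mordellCurve_addY, mordellCurve_negY, Point.some.injEq]
    constructor
    · linear_combination (-x) * hω
    · ring
  rw [add_assoc]
  change _ + ((.some (ω * x) y _ : MordellPoint c F) + .some x y h) = 0
  rw [key, add_neg_cancel]

lemma two_nsmul_mordellPoint {x y : F}
    (h : ((mordellCurve c).baseChange F).toAffine.Nonsingular x y) (hy : y ≠ 0) :
    ∃ h', 2 • (.some x y h : MordellPoint c F) =
      .some ((3 * x ^ 2 / (2 * y)) ^ 2 - 2 * x)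
        (-(3 * x ^ 2 / (2 * y) * ((3 * x ^ 2 / (2 * y)) ^ 2 - 3 * x) + y)) h' := by
  have h2 := (mordellCurve_ne_zero c F).1
  have hn : ¬ y = -y := fun hy' => by
    have : 2 * y = 0 := by linear_combination hy'
    exact hy ((mul_eq_zero.1 this).resolve_left h2)
  have hxy : ¬ (x = x ∧ y = ((mordellCurve c).baseChange F).toAffine.negY x y) := by
    simpa using hn
  have hx : ((mordellCurve c).baseChange F).toAffine.addX x x
      (((mordellCurve c).baseChange F).toAffine.slope x x y y) =
      (3 * x ^ 2 / (2 * y)) ^ 2 - 2 * x := by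
    simp only [mordellCurve_slope, if_true, if_neg hn, mordellCurve_addX]
    ring
  have hy' : ((mordellCurve c).baseChange F).toAffine.addY x x y
      (((mordellCurve c).baseChange F).toAffine.slope x x y y) =
      -(3 * x ^ 2 / (2 * y) * ((3 * x ^ 2 / (2 * y)) ^ 2 - 3 * x) + y) := by
    simp only [mordellCurve_slope, if_true, if_neg hn, mordellCurve_addY]
    ring
  have hns := nonsingular_add h h hxy
  rw [hx, hy'] at hns
  refine ⟨hns, ?_⟩
  rw [two_nsmul, Point.add_some hxy, Point.some.injEq]
  exact ⟨hx, hy'⟩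

/-- A point with `x ≠ 0` on which `mordellRot` is doubling is cut out by an explicit equation. -/
lemma mordellRot_eq_two_nsmul_iff (hω : ω ^ 2 + ω + 1 = 0) {x y : F}
    (h : ((mordellCurve c).baseChange F).toAffine.Nonsingular x y) :
    mordellRot hω (.some x y h : MordellPoint c F) = 2 • .some x y h ↔
      x ≠ 0 ∧ y ≠ 0 ∧ 9 * x ^ 3 = 4 * (2 + ω) * y ^ 2 := by
  obtain ⟨h2, hh3, -⟩ := mordellCurve_ne_zero c F
  by_cases hy : y = 0
  · subst hy
    have : (2 • .some x 0 h : MordellPoint c F) = 0 := by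
      rw [two_nsmul, Point.add_self_of_Y_eq (by simp)]
    simp [this, mordellRot]
  obtain ⟨h', e⟩ := two_nsmul_mordellPoint h hy
  rw [e]
  change Point.some (ω * x) y _ = _ ↔ _
  rw [Point.some.injEq]
  constructor
  · rintro ⟨hx, hy'⟩
    have hx0 : x ≠ 0 := by
      rintro rfl
      simp at hy'
      have : 2 * y = 0 := by linear_combination hy'
      exact hy ((mul_eq_zero.1 this).resolve_left h2)
    refine ⟨hx0, hy, ?_⟩
    field_simp at hx
    linear_combination -hx
  · rintro ⟨hx0, -, he⟩
    -- With this form of the tangent slope `l`, `l² = (2 + ω)x`; the `y`-coordinate then comes out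
    -- right because `(2 + ω)(ω - 1) = -3`.
    have hq : 3 * x ^ 2 / (2 * y) = 2 * (2 + ω) * y / (3 * x) := by
      field_simp
      linear_combination he
    have hq2 : (3 * x ^ 2 / (2 * y)) ^ 2 = (2 + ω) * x := by
      rw [div_pow, div_eq_iff (pow_ne_zero 2 (mul_ne_zero h2 hy))]
      linear_combination x * he
    rw [hq2]
    refine ⟨by ring, ?_⟩
    rw [hq]
    field_simp
    linear_combination 2 * hω

end MordellCurve

/-! ### Eigenspaces of the automorphism on the 7-torsion -/

section MordellTorsion

variable {K : Type*} [Field K] {c : K} [(mordellCurve c).IsElliptic]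
  {F : Type*} [Field F] [Algebra K F] [DecidableEq F] {ω : F}

lemma mordellRot_sq (hω : ω ^ 2 + ω + 1 = 0) (P : MordellPoint c F) :
    mordellRot (sq_sq_add_sq_add_one hω) P = mordellRot hω (mordellRot hω P) := by
  rcases P with _ | ⟨x, y, h⟩
  · rfl
  · have : ω ^ 2 * x = ω * (ω * x) := by ring
    change Point.some _ _ _ = Point.some _ _ _
    simp only [this]

lemma mordellRot_mordellRot (hω : ω ^ 2 + ω + 1 = 0) (P : MordellPoint c F) :
    mordellRot hω (mordellRot hω P) = -mordellRot hω P - P := by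
  rw [eq_sub_iff_add_eq, eq_neg_iff_add_eq_zero, add_right_comm, mordellRot_add_add]

/-- On such a point `ρ² + ρ + 1` is multiplication by `4 + 2 + 1`. -/
lemma seven_nsmul_eq_zero (hω : ω ^ 2 + ω + 1 = 0) {P : MordellPoint c F}
    (hP : mordellRot hω P = 2 • P) : 7 • P = 0 := by
  have h := mordellRot_add_add hω P
  rw [hP, map_nsmul, hP] at h
  rw [← h]
  abel

/-- Since 4 is the inverse of 2 modulo 7, replacing `ω` by `ω²` exchanges the eigenvalues.
Everything proved for eigenvalue 2 thus also covers eigenvalue 4. -/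
lemma mordellRot_eq_four_nsmul_iff (hω : ω ^ 2 + ω + 1 = 0) {P : MordellPoint c F} :
    mordellRot (sq_sq_add_sq_add_one hω) P = 2 • P ↔ mordellRot hω P = 4 • P ∧ 7 • P = 0 := by
  constructor
  · intro h
    have h7 := seven_nsmul_eq_zero _ h
    refine ⟨?_, h7⟩
    rw [mordellRot_sq hω, mordellRot_mordellRot] at h
    have e : mordellRot hω P = -(3 • P) := by
      have : mordellRot hω P = -(-mordellRot hω P - P) - P := by abel
      rw [this, h]; abel
    rw [e, neg_eq_iff_add_eq_zero, ← h7]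
    abel
  · rintro ⟨h, h7⟩
    rw [mordellRot_sq hω, h, map_nsmul, h, smul_smul, show 4 * 4 = 7 * 2 + 2 by norm_num, add_nsmul,
      mul_nsmul, h7, nsmul_zero, zero_add]

/-- The `7`-torsion is the sum of the two eigenspaces of `mordellRot`. -/
lemma exists_eq_add_of_seven_nsmul_eq_zero (hω : ω ^ 2 + ω + 1 = 0) {P : MordellPoint c F}
    (hP : 7 • P = 0) : ∃ A B : MordellPoint c F, mordellRot hω A = 2 • A ∧
      mordellRot (sq_sq_add_sq_add_one hω) B = 2 • B ∧ P = A + B := by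
  have hr : 7 • mordellRot hω P = 0 := by rw [← map_nsmul, hP, map_zero]
  -- These are the spectral projections `(ρ - 4)/(2 - 4)` and `(ρ - 2)/(4 - 2)`, with `1/2 = 4`
  -- modulo 7.
  refine ⟨-(4 • (mordellRot hω P - 4 • P)), 4 • (mordellRot hω P - 2 • P), ?_, ?_, ?_⟩
  · rw [map_neg, map_nsmul, map_sub, map_nsmul, mordellRot_mordellRot]
    rw [← sub_eq_zero]
    calc _ = 4 • (7 • mordellRot hω P) - 4 • (7 • P) := by abel
      _ = 0 := by rw [hr, hP]; simp
  · rw [mordellRot_eq_four_nsmul_iff hω]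
    constructor
    · rw [map_nsmul, map_sub, map_nsmul, mordellRot_mordellRot, ← sub_eq_zero]
      calc _ = -(4 • (7 • mordellRot hω P)) + 4 • (7 • P) := by abel
        _ = 0 := by rw [hr, hP]; simp
    · calc _ = 4 • (7 • mordellRot hω P) - 8 • (7 • P) := by abel
        _ = 0 := by rw [hr, hP]; simp
  · rw [← sub_eq_zero]
    calc _ = -(7 • P) := by abel
      _ = 0 := by rw [hP, neg_zero]

/-- `A` would have both eigenvalues 2 and 4, so both 2 and 7 kill it. -/
lemma eq_zero_of_mordellRot_add_eq_zero (hω : ω ^ 2 + ω + 1 = 0) {A B : MordellPoint c F}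
    (hA : mordellRot hω A = 2 • A) (hB : mordellRot (sq_sq_add_sq_add_one hω) B = 2 • B)
    (h : A + B = 0) : A = 0 ∧ B = 0 := by
  have h7 := seven_nsmul_eq_zero hω hA
  have hB4 := ((mordellRot_eq_four_nsmul_iff hω).1 hB).1
  have hBA : B = -A := by rw [eq_neg_iff_add_eq_zero, add_comm, h]
  have h2 : 2 • A = 0 := by
    rw [hBA, map_neg, hA] at hB4
    have : 4 • A - 2 • A = 0 := by
      rw [sub_eq_zero, ← neg_inj, hB4]; abel
    rw [← this]; abel
  have hA0 : A = 0 := by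
    calc A = 7 • A - 3 • (2 • A) := by abel
      _ = 0 := by rw [h7, h2]; simp
  exact ⟨hA0, by rw [hBA, hA0, neg_zero]⟩

/-- The coordinates of a nonzero point on which `mordellRot` is doubling. -/
lemma coordinates_of_mordellRot_eq_two_nsmul (hω : ω ^ 2 + ω + 1 = 0) {x y : F}
    (h : ((mordellCurve c).baseChange F).toAffine.Nonsingular x y)
    (hP : mordellRot hω (.some x y h : MordellPoint c F) = 2 • .some x y h) :
    1 - 4 * ω ≠ 0 ∧ x ≠ 0 ∧ y ≠ 0 ∧
      x ^ 3 = 4 * (2 + ω) * algebraMap K F c / (1 - 4 * ω) ∧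
      y ^ 2 = x ^ 3 + algebraMap K F c := by
  obtain ⟨h2, hh3, hc⟩ := mordellCurve_ne_zero c F
  obtain ⟨hx, hy, he⟩ := (mordellRot_eq_two_nsmul_iff hω h).1 hP
  have heq := (mordellCurve_nonsingular_iff x y).1 h
  have h1 : x ^ 3 * (1 - 4 * ω) = 4 * (2 + ω) * algebraMap K F c := by
    linear_combination he + 4 * (2 + ω) * heq
  have h4 : 1 - 4 * ω ≠ 0 := by
    intro h0
    rw [h0, mul_zero] at h1
    -- `2 + ω` has conjugate `1 - ω` and norm 3, so it cannot vanish.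
    have : 2 ^ 2 * 3 * algebraMap K F c = 0 := by
      linear_combination (-(1 - ω)) * h1 + (4 * algebraMap K F c) * hω
    simp [h2, hh3, hc] at this
  exact ⟨h4, hx, hy, by rw [eq_div_iff h4, h1], heq⟩

/-- The points on which `mordellRot` is doubling form a cyclic group. -/
lemma exists_zsmul_eq_of_mordellRot (hω : ω ^ 2 + ω + 1 = 0) {P Q : MordellPoint c F}
    (hP : mordellRot hω P = 2 • P) (hP0 : P ≠ 0) (hQ : mordellRot hω Q = 2 • Q) :
    ∃ n : ℤ, Q = n • P := by
  rcases Q with _ | ⟨u, v, hQ'⟩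
  · exact ⟨0, by rw [zero_smul]; rfl⟩
  rcases P with _ | ⟨x, y, hP'⟩
  · exact absurd rfl hP0
  obtain ⟨-, hx0, -, hx, hy⟩ := coordinates_of_mordellRot_eq_two_nsmul hω hP' hP
  obtain ⟨-, hu0, -, hu, hv⟩ := coordinates_of_mordellRot_eq_two_nsmul hω hQ' hQ
  have h3 := pow_three_eq_one_of_sq_add_add_one hω
  -- Equal `x³` and `y²` leave six candidates for `Q`: `±P`, `±ρP = ±2P`, `±ρ²P = ±4P`.
  have hux : u ^ 3 = x ^ 3 := by rw [hu, hx]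
  have hvy : v = y ∨ v = -y := by
    rw [← sq_eq_sq_iff_eq_or_eq_neg, hv, hy, hux]
  have hu : u = x ∨ u = ω * x ∨ u = ω * (ω * x) := by
    have : (u - x) * ((u - ω * x) * (u - ω * (ω * x))) = 0 := by
      linear_combination hux + (-u ^ 2 * x + u * x ^ 2 * ω) * hω + (- x ^ 3) * h3
    simpa [sub_eq_zero] using this
  have hmem : ∀ R : MordellPoint c F, (∃ n : ℤ, R = n • (.some x y hP' : MordellPoint c F)) →
      ∀ h, (.some u v h : MordellPoint c F) = R ∨ (.some u v h : MordellPoint c F) = -R →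
      ∃ n : ℤ, (.some u v h : MordellPoint c F) = n • (.some x y hP' : MordellPoint c F) := by
    rintro R ⟨n, rfl⟩ h (h' | h')
    · exact ⟨n, h'⟩
    · exact ⟨-n, by rw [h', neg_smul]⟩
  have hrot : mordellRot hω (mordellRot hω (.some x y hP' : MordellPoint c F)) =
      4 • (.some x y hP' : MordellPoint c F) := by
    rw [hP, map_nsmul, hP, smul_smul]; rfl
  rcases hu with rfl | rfl | rfl
  · refine hmem (.some u y hP') ⟨1, (one_zsmul _).symm⟩ hQ' ?_
    simpa using hvy
  · refine hmem (mordellRot hω (.some x y hP')) ⟨2, by rw [hP]; rfl⟩ hQ' ?_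
    change _ = Point.some _ _ _ ∨ _ = -Point.some _ _ _
    simpa using hvy
  · refine hmem (mordellRot hω (mordellRot hω (.some x y hP'))) ⟨4, by rw [hrot]; rfl⟩ hQ' ?_
    change _ = Point.some _ _ _ ∨ _ = -Point.some _ _ _
    simpa using hvy

lemma map_mordellRot {E : Type*} [Field E] [Algebra K E] [DecidableEq E] (f : F →ₐ[K] E)
    (hω : ω ^ 2 + ω + 1 = 0) {ω' : E} (hω' : ω' ^ 2 + ω' + 1 = 0) (h : f ω = ω')
    (P : MordellPoint c F) :
    Point.map f (mordellRot hω P) = mordellRot hω' (Point.map f P) := by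
  subst h
  rcases P with _ | ⟨x, y, hP⟩
  · rfl
  · change Point.some _ _ _ = Point.some _ _ _
    simp only [map_mul]

end MordellTorsion

/-- Two roots of `X² + X + 1` are equal or squares of each other. -/
lemma eq_or_eq_sq_of_sq_add_add_one {F : Type*} [Field F] {ω ω' : F} (hω : ω ^ 2 + ω + 1 = 0)
    (hω' : ω' ^ 2 + ω' + 1 = 0) : ω' = ω ∨ ω' = ω ^ 2 := by
  have : (ω' - ω) * (ω' - ω ^ 2) = 0 := by
    linear_combination hω' + (ω - 1 - ω') * hω
  simpa [sub_eq_zero] using this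

/-! ### Separability of roots -/

section Separable

variable {K : Type*} [Field K] {L : Type*} [Field L] [Algebra K L]

/-- `z` is a root of the separable polynomial `Xⁿ - zⁿ` over the separable closure, which has no
proper separable extension inside `L`. -/
lemma mem_separableClosure_of_pow {n : ℕ} (hn : (n : K) ≠ 0) {z : L} (hz : z ≠ 0)
    (h : z ^ n ∈ separableClosure K L) : z ∈ separableClosure K L := by
  let S := separableClosure K L
  let a : S := ⟨z ^ n, h⟩
  have ha : a ≠ 0 := fun h0 => pow_ne_zero n hz (congrArg Subtype.val h0)
  have hn' : (n : S) ≠ 0 := by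
    rw [← map_natCast (algebraMap K S)]
    exact (map_ne_zero _).2 hn
  have hsep := Polynomial.separable_X_pow_sub_C a hn' ha
  have hz' : IsSeparable S z := hsep.of_dvd (minpoly.dvd S z (by simp [a]))
  rw [← mem_separableClosure_iff, separableClosure.separableClosure_eq_bot,
    IntermediateField.mem_bot] at hz'
  obtain ⟨w, rfl⟩ := hz'
  exact w.2

end Separable

/-! ### Monomial matrices over `𝔽₇` and the group of order 72 -/

section Group

open Matrix

/-- The matrices over `𝔽₇` by which `Dic₃` acts. -/
def dic3Matrix : Dic3 → Matrix (Fin 2) (Fin 2) (ZMod 7)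
  | .a i => !![3 ^ (i : ZMod 6).val, 0; 0, 5 ^ (i : ZMod 6).val]
  | .xa i => !![0, 5 ^ (i : ZMod 6).val; -3 ^ (i : ZMod 6).val, 0]

/-- The matrices over `𝔽₇` by which `ℤ/6ℤ` acts. -/
def c6Matrix (k : C6) : Matrix (Fin 2) (Fin 2) (ZMod 7) :=
  !![3 ^ k.toAdd.val, 0; 0, (-3) ^ k.toAdd.val]

lemma dic3Matrix_mul : ∀ g h : Dic3, dic3Matrix (g * h) = dic3Matrix g * dic3Matrix h := by
  decide

lemma c6Matrix_mul : ∀ k l : C6, c6Matrix (k * l) = c6Matrix k * c6Matrix l := by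
  decide

/-- Conjugation by `diag(3, -3)` fixes diagonal matrices and negates antidiagonal ones, which is
inversion on the elements of order 4. -/
lemma c6Matrix_mul_dic3Matrix : ∀ (k : C6) (g : Dic3),
    c6Matrix k * dic3Matrix g = dic3Matrix (dic3Action k g) * c6Matrix k := by
  decide

/-- The `Dic₃` matrices have determinant 1, as `3 · 5 = 1`, while `diag(3, -3)` has determinant 5,
of order 6; the determinant therefore detects `k`. -/
lemma dic3Matrix_mul_c6Matrix_eq_one : ∀ (g : Dic3) (k : C6),
    dic3Matrix g * c6Matrix k = 1 → g = 1 ∧ k = 1 := by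
  decide

lemma exists_eq_diagonal : ∀ a b : ZMod 7, a ≠ 0 → b ≠ 0 →
    ∃ (i : ZMod 6) (k : C6), dic3Matrix (.a i) * c6Matrix k = !![a, 0; 0, b] := by
  decide

lemma exists_eq_antidiagonal : ∀ a b : ZMod 7, a ≠ 0 → b ≠ 0 →
    ∃ (i : ZMod 6) (k : C6), dic3Matrix (.xa i) * c6Matrix k = !![0, b; a, 0] := by
  decide

/-- The faithful representation of `Dic₃ ⋊ ℤ/6ℤ` over `𝔽₇`, whose image is the group of
invertible monomial `2 × 2` matrices. -/
def dic3SemidirectC6Matrix (d : Dic3SemidirectC6) : Matrix (Fin 2) (Fin 2) (ZMod 7) :=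
  dic3Matrix d.left * c6Matrix d.right

lemma dic3SemidirectC6Matrix_mul (d e : Dic3SemidirectC6) :
    dic3SemidirectC6Matrix (d * e) = dic3SemidirectC6Matrix d * dic3SemidirectC6Matrix e := by
  simp only [dic3SemidirectC6Matrix, SemidirectProduct.mul_left, SemidirectProduct.mul_right,
    dic3Matrix_mul, c6Matrix_mul, mul_assoc]
  rw [← mul_assoc (c6Matrix d.right) (dic3Matrix e.left), c6Matrix_mul_dic3Matrix, mul_assoc]

lemma dic3SemidirectC6Matrix_one : dic3SemidirectC6Matrix 1 = 1 := by
  decide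

lemma dic3SemidirectC6Matrix_injective : Function.Injective dic3SemidirectC6Matrix := by
  intro d e h
  have : dic3SemidirectC6Matrix (e⁻¹ * d) = 1 := by
    rw [dic3SemidirectC6Matrix_mul, h, ← dic3SemidirectC6Matrix_mul, inv_mul_cancel,
      dic3SemidirectC6Matrix_one]
  obtain ⟨h1, h2⟩ := dic3Matrix_mul_c6Matrix_eq_one _ _ this
  exact (inv_mul_eq_one.1 (SemidirectProduct.ext h1 h2)).symm

/-- A group acting monomially and faithfully on two independent vectors over `𝔽₇` embeds in
`Dic₃ ⋊ ℤ/6ℤ`. -/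
theorem exists_injective_of_monomial {G M : Type*} [Group G] [AddCommGroup M] [Module (ZMod 7) M]
    (φ : G →* AddMonoid.End M) {P Q : M}
    (hPQ : ∀ a b : ZMod 7, a • P + b • Q = 0 → a = 0 ∧ b = 0)
    (hφ : ∀ σ, ∃ a b : ZMod 7,
      (φ σ P = a • P ∧ φ σ Q = b • Q) ∨ (φ σ P = a • Q ∧ φ σ Q = b • P))
    (hf : ∀ σ, φ σ P = P → φ σ Q = Q → σ = 1) :
    ∃ f : G →* Dic3SemidirectC6, Function.Injective f := by
  have hinj : ∀ {a b a' b' : ZMod 7}, a • P + b • Q = a' • P + b' • Q → a = a' ∧ b = b' := by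
    intro a b a' b' h
    have := hPQ (a - a') (b - b') (by
      rw [sub_smul, sub_smul, ← sub_eq_zero.2 h]; abel)
    exact ⟨sub_eq_zero.1 this.1, sub_eq_zero.1 this.2⟩
  have happ : ∀ σ τ R, φ (σ * τ) R = φ σ (φ τ R) := fun σ τ R => by rw [map_mul]; rfl
  have h10 : (1 : ZMod 7) ≠ 0 := by decide
  have hz : ∀ σ R, φ σ R = 0 → R = 0 := by
    intro σ R h
    have : φ (σ⁻¹ * σ) R = 0 := by rw [happ, h, map_zero]
    simpa using this
  have hP : P ≠ 0 := fun h => h10 (hPQ 1 0 (by simp [h])).1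
  have hQ : Q ≠ 0 := fun h => h10 (hPQ 0 1 (by simp [h])).2
  have hex : ∀ σ, ∃ d : Dic3SemidirectC6,
      φ σ P = dic3SemidirectC6Matrix d 0 0 • P + dic3SemidirectC6Matrix d 1 0 • Q ∧
      φ σ Q = dic3SemidirectC6Matrix d 0 1 • P + dic3SemidirectC6Matrix d 1 1 • Q := by
    intro σ
    obtain ⟨a, b, ⟨h1, h2⟩ | ⟨h1, h2⟩⟩ := hφ σ
    all_goals
      have ha : a ≠ 0 := fun h => hP (hz σ P (by rw [h1, h, zero_smul]))
      have hb : b ≠ 0 := fun h => hQ (hz σ Q (by rw [h2, h, zero_smul]))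
    · obtain ⟨i, k, h⟩ := exists_eq_diagonal a b ha hb
      exact ⟨⟨.a i, k⟩, by simp [dic3SemidirectC6Matrix, h, h1, h2]⟩
    · obtain ⟨i, k, h⟩ := exists_eq_antidiagonal a b ha hb
      exact ⟨⟨.xa i, k⟩, by simp [dic3SemidirectC6Matrix, h, h1, h2]⟩
  choose f hf1 hf2 using hex
  -- Additive maps are automatically `𝔽₇`-linear, so composition is matrix multiplication.
  have hmul : ∀ σ τ, f (σ * τ) = f σ * f τ := by
    intro σ τ
    apply dic3SemidirectC6Matrix_injective
    have h1 := hf1 (σ * τ)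
    have h2 := hf2 (σ * τ)
    rw [happ, hf1 τ, map_add, ZMod.map_smul, ZMod.map_smul, hf1 σ,
      hf2 σ] at h1
    rw [happ, hf2 τ, map_add, ZMod.map_smul, ZMod.map_smul, hf1 σ,
      hf2 σ] at h2
    obtain ⟨e00, e10⟩ := hinj (h1.symm.trans (b := _) (c := _ • P + _ • Q) (by
      rw [smul_add, smul_add, smul_smul, smul_smul, smul_smul, smul_smul, add_add_add_comm,
        ← add_smul, ← add_smul]))
    obtain ⟨e01, e11⟩ := hinj (h2.symm.trans (b := _) (c := _ • P + _ • Q) (by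
      rw [smul_add, smul_add, smul_smul, smul_smul, smul_smul, smul_smul, add_add_add_comm,
        ← add_smul, ← add_smul]))
    rw [dic3SemidirectC6Matrix_mul]
    ext i j
    fin_cases i <;> fin_cases j <;>
      simp only [Fin.zero_eta, Fin.mk_one, Matrix.mul_apply, Fin.sum_univ_two, e00, e10, e01,
        e11] <;> ring
  refine ⟨MonoidHom.mk' f hmul, (injective_iff_map_eq_one _).2 fun σ hσ => hf σ ?_ ?_⟩
  · rw [hf1, show f σ = 1 from hσ, dic3SemidirectC6Matrix_one]; simp
  · rw [hf2, show f σ = 1 from hσ, dic3SemidirectC6Matrix_one]; simp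

/-- A group acting faithfully by scalars on a vector over `𝔽₇` embeds in `Dic₃ ⋊ ℤ/6ℤ`. -/
theorem exists_injective_of_scalar {G M : Type*} [Group G] [AddCommGroup M] [Module (ZMod 7) M]
    (φ : G →* AddMonoid.End M) {P : M} (hφ : ∀ σ, ∃ a : ZMod 7, φ σ P = a • P)
    (hf : ∀ σ, φ σ P = P → σ = 1) :
    ∃ f : G →* Dic3SemidirectC6, Function.Injective f := by
  by_cases hP : P = 0
  · exact ⟨1, (injective_iff_map_eq_one _).2 fun σ _ => hf σ (by rw [hP, map_zero])⟩
  -- On two copies of `M` a scalar becomes a scalar `2 × 2` matrix, which is monomial.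
  let ψ : G →* AddMonoid.End (M × M) :=
    { toFun σ := AddMonoidHom.prodMap (φ σ) (φ σ)
      map_one' := by rw [map_one]; rfl
      map_mul' σ τ := by rw [map_mul]; rfl }
  have hψ : ∀ σ (R : M × M), ψ σ R = (φ σ R.1, φ σ R.2) := fun _ _ => rfl
  refine exists_injective_of_monomial ψ (P := (P, 0)) (Q := (0, P)) ?_ ?_ ?_
  · intro a b h
    have : Fact (Nat.Prime 7) := ⟨by norm_num⟩
    simpa [hP] using h
  · intro σ
    obtain ⟨a, ha⟩ := hφ σ
    exact ⟨a, a, Or.inl (by simp [hψ, ha])⟩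
  · intro σ h _
    rw [hψ] at h
    exact hf σ (congrArg Prod.fst h)

/-- The only involution of `Dic₃` is the central `a³`, so involutions of the direct product are
central. In the semidirect product, an order 4 element times the involution of `ℤ/6ℤ`, which inverts
it, is an involution not commuting with `a`. -/
lemma isEmpty_dic3SemidirectC6_mulEquiv_prod : IsEmpty (Dic3SemidirectC6 ≃* Dic3 × C6) := by
  refine ⟨fun e => ?_⟩
  have hcomm : ∀ g h : Dic3 × C6, g * g = 1 → g * h = h * g := by
    have : ∀ g h : Dic3, g * g = 1 → g * h = h * g := by decide
    intro g h hg
    exact Prod.ext (this _ _ (congrArg Prod.fst hg)) (mul_comm _ _)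
  let s : Dic3SemidirectC6 := ⟨.xa 0, .ofAdd 3⟩
  let t : Dic3SemidirectC6 := ⟨.a 1, 1⟩
  have hs : s * s = 1 := by decide
  have hst : s * t ≠ t * s := by decide
  refine hst (e.injective ?_)
  rw [map_mul, map_mul]
  exact hcomm _ _ (by rw [← map_mul, hs, map_one])

lemma card_dic3SemidirectC6 : Nat.card Dic3SemidirectC6 = 72 := by
  rw [Nat.card_congr SemidirectProduct.equivProd, Nat.card_prod]
  simp [QuaternionGroup.card]

end Group

/-! ### The Galois action on the 7-torsion -/

section Galois

variable {K : Type*} [Field K] (c : K) (F : Type*) [Field F] [Algebra K F] [DecidableEq F]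

/-- The `7`-torsion subgroup of the `F`-rational points of `y² = x³ + c`. -/
def sevenTorsion : AddSubgroup (MordellPoint c F) := (nsmulAddMonoidHom 7).ker

variable {c F}

lemma mem_sevenTorsion {P : MordellPoint c F} : P ∈ sevenTorsion c F ↔ 7 • P = 0 := Iff.rfl

variable (c F) in
/-- The `7`-torsion as a vector space over `𝔽₇`. -/
instance sevenTorsion.module : Module (ZMod 7) (sevenTorsion c F) :=
  AddCommGroup.zmodModule fun P => Subtype.ext P.2

lemma sevenTorsion_intCast_smul (n : ℤ) (P : sevenTorsion c F) : (n : ZMod 7) • P = n • P :=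
  Int.cast_smul_eq_zsmul _ _ _

variable (c F) in
/-- The action of the automorphisms of `F` over `K` on the `7`-torsion. -/
noncomputable def sevenTorsionRep : Gal(F/K) →* AddMonoid.End (sevenTorsion c F) where
  toFun σ :=
    { toFun P := ⟨Point.map (W' := mordellCurve c) σ.toAlgHom P.1, by
        rw [mem_sevenTorsion, ← map_nsmul, mem_sevenTorsion.1 P.2, map_zero]⟩
      map_zero' := rfl
      map_add' P Q := Subtype.ext (map_add _ _ _) }
  map_one' := by
    ext ⟨P, hP⟩
    rcases P with _ | ⟨x, y, h⟩ <;> rfl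
  map_mul' σ τ := by
    ext ⟨P, hP⟩
    rcases P with _ | ⟨x, y, h⟩ <;> rfl

lemma coe_sevenTorsionRep (σ : Gal(F/K)) (P : sevenTorsion c F) :
    (sevenTorsionRep c F σ P : MordellPoint c F) = Point.map σ.toAlgHom P.1 := rfl

variable [(mordellCurve c).IsElliptic] {ω : F}

lemma exists_smul_eq_of_mordellRot (hω : ω ^ 2 + ω + 1 = 0) {P Q : sevenTorsion c F}
    (hP : mordellRot hω P.1 = 2 • P.1) (hP0 : P ≠ 0) (hQ : mordellRot hω Q.1 = 2 • Q.1) :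
    ∃ a : ZMod 7, Q = a • P := by
  obtain ⟨n, hn⟩ := exists_zsmul_eq_of_mordellRot hω hP (fun h => hP0 (Subtype.ext h)) hQ
  exact ⟨n, by rw [sevenTorsion_intCast_smul]; exact Subtype.ext hn⟩

lemma mordellRot_smul (hω : ω ^ 2 + ω + 1 = 0) {P : sevenTorsion c F}
    (hP : mordellRot hω P.1 = 2 • P.1) (a : ZMod 7) :
    mordellRot hω (a • P).1 = 2 • (a • P).1 := by
  obtain ⟨n, rfl⟩ := ZMod.intCast_surjective a
  rw [sevenTorsion_intCast_smul, AddSubgroup.coe_zsmul, map_zsmul, hP, smul_comm]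

/-- An automorphism permutes the two eigenspaces of `mordellRot`. -/
lemma mordellRot_map (hω : ω ^ 2 + ω + 1 = 0) {ω' : F} (hω' : ω' ^ 2 + ω' + 1 = 0) {σ : Gal(F/K)}
    (h : σ ω = ω') {P : sevenTorsion c F} (hP : mordellRot hω P.1 = 2 • P.1) :
    mordellRot hω' (sevenTorsionRep c F σ P).1 = 2 • (sevenTorsionRep c F σ P).1 := by
  rw [coe_sevenTorsionRep, ← map_mordellRot σ.toAlgHom hω hω' h, hP, map_nsmul]

/-- If `F` contains the cube roots of unity and its automorphisms act faithfully on the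
`7`-torsion, then they form a group that embeds in `Dic₃ ⋊ ℤ/6ℤ`. -/
theorem exists_injective_of_faithful (hω : ω ^ 2 + ω + 1 = 0)
    (hf : ∀ σ : Gal(F/K), (∀ P : sevenTorsion c F, sevenTorsionRep c F σ P = P) → σ = 1) :
    ∃ f : Gal(F/K) →* Dic3SemidirectC6, Function.Injective f := by
  have hω2 := sq_sq_add_sq_add_one hω
  have hdec : ∀ R : sevenTorsion c F, ∃ A B : sevenTorsion c F, mordellRot hω A.1 = 2 • A.1 ∧
      mordellRot hω2 B.1 = 2 • B.1 ∧ R = A + B := by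
    intro R
    obtain ⟨A, B, hA, hB, h⟩ := exists_eq_add_of_seven_nsmul_eq_zero hω R.2
    exact ⟨⟨A, seven_nsmul_eq_zero _ hA⟩, ⟨B, seven_nsmul_eq_zero _ hB⟩, hA, hB, Subtype.ext h⟩
  -- Degenerate case: the 7-torsion over `F` is spanned by one vector, so the action is scalar.
  have key : ∀ {P : sevenTorsion c F},
      (∀ R, ∃ a : ZMod 7, R = a • P) → ∃ f : Gal(F/K) →* Dic3SemidirectC6, Function.Injective f := by
    intro P h
    refine exists_injective_of_scalar (sevenTorsionRep c F) (P := P) (fun σ => h _) ?_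
    intro σ hσ
    refine hf σ fun R => ?_
    obtain ⟨a, rfl⟩ := h R
    rw [ZMod.map_smul, hσ]
  by_cases h1 : ∃ P : sevenTorsion c F, mordellRot hω P.1 = 2 • P.1 ∧ P ≠ 0
  · obtain ⟨P, hP, hP0⟩ := h1
    by_cases h2 : ∃ Q : sevenTorsion c F, mordellRot hω2 Q.1 = 2 • Q.1 ∧ Q ≠ 0
    · obtain ⟨Q, hQ, hQ0⟩ := h2
      have : Fact (Nat.Prime 7) := ⟨by norm_num⟩
      refine exists_injective_of_monomial (sevenTorsionRep c F) (P := P) (Q := Q) ?_ ?_ ?_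
      · intro a b hab
        obtain ⟨ha, hb⟩ := eq_zero_of_mordellRot_add_eq_zero hω (mordellRot_smul hω hP a)
          (mordellRot_smul hω2 hQ b) (congrArg Subtype.val hab)
        exact ⟨(smul_eq_zero.1 (Subtype.ext ha : a • P = 0)).resolve_right hP0,
          (smul_eq_zero.1 (Subtype.ext hb : b • Q = 0)).resolve_right hQ0⟩
      · intro σ
        have hσω : (σ ω) ^ 2 + σ ω + 1 = 0 := by
          simpa using congrArg σ hω
        rcases eq_or_eq_sq_of_sq_add_add_one hω hσω with h | h
        · obtain ⟨a, ha⟩ := exists_smul_eq_of_mordellRot hω hP hP0 (mordellRot_map hω hω h hP)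
          obtain ⟨b, hb⟩ := exists_smul_eq_of_mordellRot hω2 hQ hQ0
            (mordellRot_map hω2 hω2 (by rw [map_pow, h]) hQ)
          exact ⟨a, b, Or.inl ⟨ha, hb⟩⟩
        · obtain ⟨a, ha⟩ := exists_smul_eq_of_mordellRot hω2 hQ hQ0 (mordellRot_map hω hω2 h hP)
          obtain ⟨b, hb⟩ := exists_smul_eq_of_mordellRot hω hP hP0
            (mordellRot_map hω2 hω (by
              rw [map_pow, h]
              linear_combination ω * pow_three_eq_one_of_sq_add_add_one hω) hQ)
          exact ⟨a, b, Or.inr ⟨ha, hb⟩⟩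
      · intro σ hσP hσQ
        refine hf σ fun R => ?_
        obtain ⟨A, B, hA, hB, rfl⟩ := hdec R
        obtain ⟨a, rfl⟩ := exists_smul_eq_of_mordellRot hω hP hP0 hA
        obtain ⟨b, rfl⟩ := exists_smul_eq_of_mordellRot hω2 hQ hQ0 hB
        rw [map_add, ZMod.map_smul, ZMod.map_smul, hσP, hσQ]
    · push Not at h2
      refine key (P := P) fun R => ?_
      obtain ⟨A, B, hA, hB, rfl⟩ := hdec R
      rw [h2 B hB, add_zero]
      exact exists_smul_eq_of_mordellRot hω hP hP0 hA
  · push Not at h1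
    by_cases h2 : ∃ Q : sevenTorsion c F, mordellRot hω2 Q.1 = 2 • Q.1 ∧ Q ≠ 0
    · obtain ⟨Q, hQ, hQ0⟩ := h2
      refine key (P := Q) fun R => ?_
      obtain ⟨A, B, hA, hB, rfl⟩ := hdec R
      rw [h1 A hA, zero_add]
      exact exists_smul_eq_of_mordellRot hω2 hQ hQ0 hB
    · push Not at h2
      refine key (P := 0) fun R => ⟨0, ?_⟩
      obtain ⟨A, B, hA, hB, rfl⟩ := hdec R
      rw [h1 A hA, h2 B hB, zero_add, zero_smul]

end Galois

/-! ### The division field: faithful action, separability, normality -/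

section DivisionField

lemma exists_sq_add_add_one_eq_zero (L : Type*) [Field L] [IsAlgClosed L] : ∃ ω : L, ω ^ 2 + ω + 1 = 0 := by
  obtain ⟨ω, h⟩ := IsAlgClosed.exists_root (Polynomial.X ^ 2 + Polynomial.X + 1 : Polynomial L)
    (by
      have : (Polynomial.X ^ 2 + Polynomial.X + 1 : Polynomial L).degree = 2 := by compute_degree!
      rw [this]; norm_num)
  exact ⟨ω, by simpa using h⟩

variable {K : Type*} [Field K] (c : K) (L : Type*) [Field L] [Algebra K L] [DecidableEq L]

variable {c L} in
lemma exists_map_eq_of_mem [(mordellCurve c).IsElliptic] (E : IntermediateField K L) {x y : L}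
    (h : ((mordellCurve c).baseChange L).toAffine.Nonsingular x y) (hx : x ∈ E) (hy : y ∈ E) :
    ∃ h', Point.map E.val (.some ⟨x, hx⟩ ⟨y, hy⟩ h' : MordellPoint c E) =
      (.some x y h : MordellPoint c L) :=
  ⟨(mordellCurve_nonsingular_iff _ _).2
    (Subtype.ext ((mordellCurve_nonsingular_iff x y).1 h)), rfl⟩

variable {c L} in
/-- The `7`-torsion points are rational over the division field. -/
lemma exists_map_divisionField_eq [(mordellCurve c).IsElliptic] {x y : L}
    (h : ((mordellCurve c).baseChange L).toAffine.Nonsingular x y)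
    (h7 : 7 • (.some x y h : MordellPoint c L) = 0) :
    ∃ (hx : x ∈ divisionField (mordellCurve c) L 7) (hy : y ∈ divisionField (mordellCurve c) L 7)
      (h' : _), (.some ⟨x, hx⟩ ⟨y, hy⟩ h' : MordellPoint c (divisionField (mordellCurve c) L 7)) ∈
        sevenTorsion c (divisionField (mordellCurve c) L 7) := by
  have hx : x ∈ divisionField (mordellCurve c) L 7 :=
    IntermediateField.subset_adjoin _ _ ⟨x, y, h, h7, .inl rfl⟩
  have hy : y ∈ divisionField (mordellCurve c) L 7 :=
    IntermediateField.subset_adjoin _ _ ⟨x, y, h, h7, .inr rfl⟩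
  obtain ⟨h', e⟩ := exists_map_eq_of_mem (divisionField (mordellCurve c) L 7) h hx hy
  refine ⟨hx, hy, h', mem_sevenTorsion.2 ?_⟩
  apply Point.map_injective (W' := mordellCurve c) (divisionField (mordellCurve c) L 7).val
  rw [map_nsmul, e, h7, map_zero]

lemma eq_one_of_sevenTorsionRep_eq_one [(mordellCurve c).IsElliptic]
    (σ : Gal(divisionField (mordellCurve c) L 7/K))
    (hσ : ∀ P, sevenTorsionRep c (divisionField (mordellCurve c) L 7) σ P = P) : σ = 1 := by
  have : σ.toAlgHom = (1 : Gal(divisionField (mordellCurve c) L 7/K)).toAlgHom := by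
    refine IntermediateField.algHom_ext_of_eq_adjoin K (S := divisionField (mordellCurve c) L 7)
      rfl ?_
    rintro z ⟨x, y, h, h7, hz⟩
    obtain ⟨hx, hy, h', hmem⟩ := exists_map_divisionField_eq h h7
    have e := congrArg Subtype.val (hσ ⟨_, hmem⟩)
    rw [coe_sevenTorsionRep, Point.map_some, Point.some.injEq] at e
    rcases hz with rfl | rfl
    · exact e.1
    · exact e.2
  ext z
  exact congrArg Subtype.val (DFunLike.congr_fun this z)

theorem exists_injective_gal_divisionField [(mordellCurve c).IsElliptic] [IsAlgClosed L] :
    ∃ f : Gal(divisionField (mordellCurve c) L 7/K) →* Dic3SemidirectC6,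
      Function.Injective f := by
  obtain ⟨ω, hω⟩ := exists_sq_add_add_one_eq_zero L
  by_cases hmem : ω ∈ divisionField (mordellCurve c) L 7
  · exact exists_injective_of_faithful
      (ω := (⟨ω, hmem⟩ : divisionField (mordellCurve c) L 7)) (Subtype.ext hω)
      (eq_one_of_sevenTorsionRep_eq_one c L)
  -- A nonzero eigenpoint would put `x` and `ζx` in the division field, hence also `ζ = ζx / x`. So
  -- without `ω` there is no nonzero 7-torsion and the group is trivial.
  · have hzero : ∀ {ζ : L} (hζ : ζ ^ 2 + ζ + 1 = 0),
        ζ ∉ divisionField (mordellCurve c) L 7 → ∀ A : MordellPoint c L,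
        mordellRot hζ A = 2 • A → A = 0 := by
      intro ζ hζ hζ' A hA
      rcases A with _ | ⟨x, y, h⟩
      · rfl
      exfalso
      have h7 := seven_nsmul_eq_zero hζ hA
      obtain ⟨hx, -⟩ := exists_map_divisionField_eq h h7
      have h7' : 7 • mordellRot hζ (.some x y h : MordellPoint c L) = 0 := by
        rw [← map_nsmul, h7, map_zero]
      obtain ⟨hx', -⟩ := exists_map_divisionField_eq _ h7'
      have hx0 := (coordinates_of_mordellRot_eq_two_nsmul hζ h hA).2.1
      apply hζ'
      rw [← mul_div_cancel_right₀ ζ hx0]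
      exact div_mem hx' hx
    have hmem2 : ω ^ 2 ∉ divisionField (mordellCurve c) L 7 := by
      intro h
      apply hmem
      have : ω = (ω ^ 2) ^ 2 := by
        linear_combination -ω * pow_three_eq_one_of_sq_add_add_one hω
      rw [this]
      exact pow_mem h 2
    have htriv : ∀ P : MordellPoint c L, 7 • P = 0 → P = 0 := by
      intro P hP
      obtain ⟨A, B, hA, hB, rfl⟩ := exists_eq_add_of_seven_nsmul_eq_zero hω hP
      rw [hzero hω hmem A hA, hzero _ hmem2 B hB, add_zero]
    refine ⟨1, (injective_iff_map_eq_one _).2 fun σ _ =>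
      eq_one_of_sevenTorsionRep_eq_one c L σ fun P => ?_⟩
    have hP : P = 0 := by
      apply Subtype.ext
      apply Point.map_injective (W' := mordellCurve c) (divisionField (mordellCurve c) L 7).val
      exact htriv _ (by rw [← map_nsmul, mem_sevenTorsion.1 P.2, map_zero])
    rw [hP, map_zero]

variable {c L} in
/-- Points on which `mordellRot` is doubling have coordinates separable over `K`. -/
lemma coordinates_mem_separableClosure [(mordellCurve c).IsElliptic] {ω : L}
    (hω : ω ^ 2 + ω + 1 = 0) {x y : L}
    (h : ((mordellCurve c).baseChange L).toAffine.Nonsingular x y)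
    (hP : mordellRot hω (.some x y h : MordellPoint c L) = 2 • .some x y h) :
    x ∈ separableClosure K L ∧ y ∈ separableClosure K L := by
  obtain ⟨h2, h3, -⟩ := mordellCurve_ne_zero c K
  obtain ⟨-, hx0, hy0, hx, hy⟩ := coordinates_of_mordellRot_eq_two_nsmul hω h hP
  have hω3 := pow_three_eq_one_of_sq_add_add_one hω
  have hωS : ω ∈ separableClosure K L := by
    -- `ω` is a cube root of 1, `x` a cube root of an element of `K(ω)`, and `y` a square root; 2
    -- and 3 are invertible in `K`.
    refine mem_separableClosure_of_pow (n := 3) (by exact_mod_cast h3) ?_ ?_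
    · rintro rfl
      simp at hω3
    · rw [hω3]
      exact one_mem _
  have hc : algebraMap K L c ∈ separableClosure K L := algebraMap_mem _ _
  have hn : ∀ n : ℕ, (n : L) ∈ separableClosure K L := natCast_mem _
  have hx3 : x ^ 3 ∈ separableClosure K L := by
    rw [hx]
    exact div_mem (mul_mem (mul_mem (by exact_mod_cast hn 4)
      (add_mem (by exact_mod_cast hn 2) hωS)) hc)
      (sub_mem (one_mem _) (mul_mem (by exact_mod_cast hn 4) hωS))
  exact ⟨mem_separableClosure_of_pow (n := 3) (by exact_mod_cast h3) hx0 hx3,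
    mem_separableClosure_of_pow (n := 2) (by exact_mod_cast h2) hy0
      (by rw [hy]; exact add_mem hx3 hc)⟩

/-- Points with separable coordinates form a subgroup containing both eigenspaces, hence all the
7-torsion. -/
lemma isSeparable_divisionField [(mordellCurve c).IsElliptic] [IsAlgClosed L] :
    Algebra.IsSeparable K (divisionField (mordellCurve c) L 7) := by
  obtain ⟨ω, hω⟩ := exists_sq_add_add_one_eq_zero L
  let f : MordellPoint c (separableClosure K L) →+ MordellPoint c L :=
    Point.map (separableClosure K L).val
  have hrange : ∀ {ζ : L} (hζ : ζ ^ 2 + ζ + 1 = 0) (A : MordellPoint c L),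
      mordellRot hζ A = 2 • A → A ∈ f.range := by
    intro ζ hζ A hA
    rcases A with _ | ⟨x, y, h⟩
    · exact zero_mem _
    obtain ⟨hx, hy⟩ := coordinates_mem_separableClosure hζ h hA
    obtain ⟨h', e⟩ := exists_map_eq_of_mem (separableClosure K L) h hx hy
    exact ⟨_, e⟩
  refine (IntermediateField.isSeparable_adjoin_iff_isSeparable (F := K) (E := L)).2 ?_
  rintro z ⟨x, y, h, h7, hz⟩
  obtain ⟨A, B, hA, hB, hAB⟩ := exists_eq_add_of_seven_nsmul_eq_zero hω h7
  have hmem : (.some x y h : MordellPoint c L) ∈ f.range := by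
    rw [hAB]
    exact add_mem (hrange hω A hA) (hrange _ B hB)
  obtain ⟨_ | ⟨u, v, huv⟩, hQ⟩ := hmem
  · cases hQ
  · change Point.some _ _ _ = _ at hQ
    rw [Point.some.injEq] at hQ
    rw [← mem_separableClosure_iff]
    rcases hz with rfl | rfl
    · rw [← hQ.1]; exact u.2
    · rw [← hQ.2]; exact v.2

lemma normal_divisionField [Normal K L] : Normal K (divisionField (mordellCurve c) L 7) := by
  rw [IntermediateField.normal_iff_forall_map_le]
  intro σ
  rw [divisionField, IntermediateField.adjoin_map]
  refine IntermediateField.adjoin.mono _ _ _ ?_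
  rintro _ ⟨z, ⟨x, y, h, h7, hz⟩, rfl⟩
  have h7' := congrArg (Point.map (W' := mordellCurve c) σ) h7
  rw [map_nsmul, map_zero, Point.map_some] at h7'
  exact ⟨σ x, σ y, _, h7', by rcases hz with rfl | rfl <;> simp⟩

theorem isGalois_divisionField [(mordellCurve c).IsElliptic] [IsAlgClosure K L] :
    IsGalois K (divisionField (mordellCurve c) L 7) := by
  have : IsAlgClosed L := IsAlgClosure.isAlgClosed K
  have : Normal K L := IsAlgClosure.normal K L
  exact { to_isSeparable := isSeparable_divisionField c L
          to_normal := normal_divisionField c L }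

end DivisionField

theorem theorem6 {K : Type*} [Field K] (h2 : ringChar K ≠ 2) (h3 : ringChar K ≠ 3)
    (L : Type*) [Field L] [Algebra K L] [IsAlgClosure K L] [DecidableEq L]
    (c : K) [(mordellCurve c).IsElliptic] :
    IsGalois K (divisionField (mordellCurve c) L 7) ∧
    (∃ S : Subgroup Dic3SemidirectC6,
      Nonempty (Gal(divisionField (mordellCurve c) L 7/K) ≃* S)) ∧
    (Module.finrank K (divisionField (mordellCurve c) L 7) = 72 →
      Nonempty (Gal(divisionField (mordellCurve c) L 7/K) ≃* Dic3SemidirectC6)) ∧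
    IsEmpty (Dic3SemidirectC6 ≃* Dic3 × C6) := by
  have : IsAlgClosed L := IsAlgClosure.isAlgClosed K
  have hG := isGalois_divisionField c L
  obtain ⟨f, hf⟩ := exists_injective_gal_divisionField c L
  refine ⟨hG, ⟨f.range, ⟨MonoidHom.ofInjective hf⟩⟩, fun h72 => ?_,
    isEmpty_dic3SemidirectC6_mulEquiv_prod⟩
  have : FiniteDimensional K (divisionField (mordellCurve c) L 7) :=
    FiniteDimensional.of_finrank_pos (by rw [h72]; norm_num)
  have : Finite Dic3SemidirectC6 :=
    Nat.finite_of_card_ne_zero (by rw [card_dic3SemidirectC6]; norm_num)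
  have hcard : Nat.card Gal(divisionField (mordellCurve c) L 7/K) = Nat.card Dic3SemidirectC6 := by
    rw [IsGalois.card_aut_eq_finrank, h72, card_dic3SemidirectC6]
  exact ⟨MulEquiv.ofBijective f ((Nat.bijective_iff_injective_and_card f).2 ⟨hf, hcard⟩)⟩
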